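/- Let $f:\mathbb{R}\to\mathbb{R}$ be locally Lipschitz continuous with $f(0)=0$ and $yf(y)>0$ for all $y\neq 0$. Let $g:[0,\infty)\to\mathbb{R}$ be continuous with $g(t)>0$ for $t>0$, let $\xi>0$, and let $x$ be the unique continuous solution on $[0,\infty)$ of $$x'(t)=-f(x(t))+g(t),\quad t>0;\qquad x(0)=\xi .$$ Put $F(y)=\int_y^1 \frac{du}{f(u)}$ for $y>0$. This is a strictly decreasing function with $F(0+)=\infty$; let $F^{-1}$ be its inverse, which is defined in particular on $[0,\infty)$. A measurable $h:(0,\infty)\to(0,\infty)$ is in $\mathrm{RV}_0(\beta)$ if $\lim_{y\to0^+}h(\lambda y)/h(y)=\lambda^\beta$ for all $\lambda>0$. A measurable $h:[0,\infty)\to(0,\infty)$ is in $\mathrm{RV}_\infty(\alpha)$ if $\lim_{t\to\infty}h(\lambda t)/h(t)=\lambda^\alpha$ for all $\lambda>0$. Suppose that - $f\in \mathrm{RV}_0(\beta)$ for some $\beta>1$, or $f\circ F^{-1}\in\mathrm{RV}_\infty(-1)$; - there are $\delta>0$ and a function $\phi$, increasing (not necessarily strictly) on $(0,\delta)$, with $\lim_{y\to0^+}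 f(y)/\phi(y)=1$; - $x(t)\to0$ as $t\to\infty$; - $\lim_{t\to\infty} \dfrac{g(t)}{f(F^{-1}(t))}=L$ for some $L\in[0,\infty]$. Then: (i) If $L=0$, then $\lim_{t\to\infty}F(x(t))/t=1$. (ii) If $L\in(0,\infty)$, then $\lim_{t\to\infty}F(x(t))/t=\Lambda_*(L)\in(0,1)$, where (I) if $f\in\mathrm{RV}_0(\beta)$ with $\beta>1$, $\Lambda_*(L)$ is the unique $\Lambda>0$ with $(1-\Lambda)\Lambda^{-\beta/(\beta-1)}=L$ (it exists and lies in $(0,1)$); and (II) if $f\circ F^{-1}\in\mathrm{RV}_\infty(-1)$, $\Lambda_*(L)=1/(1+L)$. (iii) If $L=\infty$, then $\lim_{t\to\infty}F(x(t))/t=0$. -/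

import Mathlib

open Filter Topology Set

noncomputable section

/-- Regular variation at `0` with index `β`, for a function on `(0, ∞)`
(values of `f` outside `(0, ∞)` play no role). -/
def RegVaryAtZero (f : ℝ → ℝ) (β : ℝ) : Prop :=
  Measurable ((Ioi (0 : ℝ)).domRestrict f) ∧ (∀ x > 0, 0 < f x) ∧
    ∀ c > 0, Tendsto (fun x => f (c * x) / f x) (𝓝[>] 0) (𝓝 (c ^ β))

/-- Regular variation at infinity with index `α`, for a function on `[0, ∞)`
(values of `h` outside `[0, ∞)` play no role). -/
def RegVaryAtInfty (h : ℝ → ℝ) (α : ℝ) : Prop :=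
  Measurable ((Ici (0 : ℝ)).domRestrict h) ∧ (∀ t ≥ 0, 0 < h t) ∧
    ∀ c > 0, Tendsto (fun t => h (c * t) / h t) atTop (𝓝 (c ^ α))

/-- `F(x) = ∫_x^1 du / f(u)`, for `x > 0`. -/
def decayF (f : ℝ → ℝ) (x : ℝ) : ℝ := ∫ u in x..1, 1 / f u

/-- The inverse `F⁻¹` of `F : (0, ∞) → ℝ`. For `f` locally Lipschitz with `f 0 = 0` and
`x * f x > 0` for `x ≠ 0`, `F` is strictly decreasing and `F(0+) = ∞`, so every `t ≥ 0` is
attained on `(0, ∞)` and `decayFInv f t` is its unique preimage there. -/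
def decayFInv (f : ℝ → ℝ) : ℝ → ℝ := Function.invFunOn (decayF f) (Ioi 0)

/-- `f` is asymptotic, at `0+`, to a function that is increasing on some `(0, δ)`. -/
def AsympIncreasingAtZero (f : ℝ → ℝ) : Prop :=
  ∃ (φ : ℝ → ℝ) (δ : ℝ), 0 < δ ∧ MonotoneOn φ (Ioo 0 δ) ∧
    Tendsto (fun x => f x / φ x) (𝓝[>] 0) (𝓝 1)

/-- `x` is a continuous solution on `[0, ∞)` of `x' = -f(x) + g` for `t > 0`, `x(0) = ξ`. -/
structure IsPerturbedSolution (f g : ℝ → ℝ) (ξ : ℝ) (x : ℝ → ℝ) : Prop where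
  continuousOn : ContinuousOn x (Ici 0)
  init : x 0 = ξ
  hasDerivAt : ∀ t > 0, HasDerivAt x (-f (x t) + g t) t

end

/-! The function `y(t) = F(x(t))` satisfies `y' = 1 - g / f(x)`, and it is compared with lines `c *
t`. When `y` is above the line, `x ≤ F⁻¹(c t)`, so asymptotic monotonicity gives `f(x) ≤ K f(F⁻¹(c
t))` with `K` close to 1. If `f ∘ F⁻¹` has index `-γ`, then `g / f(F⁻¹(c t))` tends to `L c^γ`, so
`y'` is below `c` by a margin whenever `1 - c < L c^γ`, and `y` ends up under the line. The reverse
inequality pushes `y` above it. The critical slope is the root of `1 - Λ = L Λ^γ`; for `L = ∞` every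
`c > 0` is an upper slope. Here `γ = 1` in case (II), and `γ = β / (β - 1)` in case (I) by
`RegVaryAtZero.tendsto_comp_decayFInv`. The comparison is carried by
`eventually_le_line_of_deriv_le`. -/

/-- If `p' / q'` is eventually at most `a` at `0+`, with `q' < 0` and `q → ∞`, then `p / q` is
eventually below every number exceeding `a`. -/
lemma eventually_div_lt_of_deriv_div_le {p q p' q' : ℝ → ℝ} {a b : ℝ} (hab : a < b)
    (hp : ∀ y > 0, HasDerivAt p (p' y) y) (hq : ∀ y > 0, HasDerivAt q (q' y) y)
    (hq' : ∀ y > 0, q' y < 0) (hqt : Tendsto q (𝓝[>] 0) atTop)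
    (h : ∀ᶠ y in 𝓝[>] 0, p' y / q' y ≤ a) :
    ∀ᶠ y in 𝓝[>] 0, p y / q y < b := by
  obtain ⟨r, hr, hsub⟩ := mem_nhdsGT_iff_exists_Ioo_subset.1 h
  have hr0 : (0 : ℝ) < r := hr
  have hmono : MonotoneOn (fun y => p y - a * q y) (Ioo 0 r) := by
    have hd : ∀ y ∈ Ioo 0 r, HasDerivAt (fun y => p y - a * q y) (p' y - a * q' y) y :=
      fun y hy => (hp y hy.1).sub ((hq y hy.1).const_mul a)
    refine monotoneOn_of_deriv_nonneg (convex_Ioo 0 r)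
      (fun y hy => (hd y hy).continuousAt.continuousWithinAt) ?_ ?_
    · rw [interior_Ioo]
      exact fun y hy => (hd y hy).differentiableAt.differentiableWithinAt
    · rw [interior_Ioo]
      intro y hy
      rw [(hd y hy).deriv]
      have h1 : p' y / q' y ≤ a := hsub hy
      rw [div_le_iff_of_neg (hq' y hy.1)] at h1
      linarith
  -- `p - a * q` stays below this constant near 0, and `(b - a) * q` eventually exceeds it.
  set C := p (r / 2) - a * q (r / 2) with hC
  have h2 : ∀ᶠ y in 𝓝[>] (0 : ℝ), y ∈ Ioo 0 (r / 2) := Ioo_mem_nhdsGT (by linarith)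
  filter_upwards [h2, hqt.eventually_gt_atTop 0, hqt.eventually_gt_atTop (C / (b - a))]
    with y hy hq0 hqC
  have h3 : p y - a * q y ≤ C :=
    hmono ⟨hy.1, by linarith [hy.2]⟩ ⟨by linarith, by linarith⟩ hy.2.le
  rw [div_lt_iff₀ (by linarith)] at hqC
  rw [div_lt_iff₀ hq0]
  linarith

/-- L'Hôpital's rule at `0+` in the `∞/∞` form. -/
lemma tendsto_div_of_tendsto_deriv_div {p q p' q' : ℝ → ℝ} {l : ℝ}
    (hp : ∀ y > 0, HasDerivAt p (p' y) y) (hq : ∀ y > 0, HasDerivAt q (q' y) y)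
    (hq' : ∀ y > 0, q' y < 0) (hqt : Tendsto q (𝓝[>] 0) atTop)
    (h : Tendsto (fun y => p' y / q' y) (𝓝[>] 0) (𝓝 l)) :
    Tendsto (fun y => p y / q y) (𝓝[>] 0) (𝓝 l) := by
  refine tendsto_order.2 ⟨fun b hb => ?_, fun b hb => ?_⟩
  · obtain ⟨a, hba, hal⟩ := exists_between hb
    have h1 := eventually_div_lt_of_deriv_div_le (p := fun y => -p y) (p' := fun y => -p' y)
      (neg_lt_neg hba) (fun y hy => (hp y hy).neg) hq hq' hqt
      ((h.eventually_const_le hal).mono fun y hy => by rw [neg_div]; exact neg_le_neg hy)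
    filter_upwards [h1] with y hy
    rw [neg_div] at hy
    linarith
  · obtain ⟨a, hla, hab⟩ := exists_between hb
    exact eventually_div_lt_of_deriv_div_le hab hp hq hq' hqt (h.eventually_le_const hla)

/-! ### Comparison with lines, and asymptotic monotonicity -/

/-- A function whose graph goes down relative to the line `c * t` whenever it is on or above it
ends up below this line. -/
lemma eventually_le_line_of_deriv_le {y y' : ℝ → ℝ} {c η : ℝ} (hη : 0 < η)
    (hy : ∀ t > 0, HasDerivAt y (y' t) t)
    (h : ∀ᶠ t in atTop, c * t ≤ y t → y' t ≤ c - η) :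
    ∀ᶠ t in atTop, y t ≤ c * t := by
  obtain ⟨T, hT⟩ := eventually_atTop.1 (h.and (eventually_gt_atTop (0 : ℝ)))
  have hT0 : 0 < T := (hT T le_rfl).2
  have hline : ∀ (k d t : ℝ), HasDerivAt (fun s => k * s + d) k t := fun k d t => by
    simpa using ((hasDerivAt_id t).const_mul k).add_const d
  -- Above the line the gap `y t - c * t` shrinks at rate at least `η`; `t₂` is one unit past the
  -- time by which it must be used up.
  obtain ⟨t₁, ht₁, hle⟩ : ∃ t₁ ≥ T, y t₁ ≤ c * t₁ := by
    by_contra! hcon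
    set t₂ := T + (y T - c * T) / η + 1 with ht₂
    have hT2 : T ≤ t₂ := by
      have : 0 ≤ (y T - c * T) / η := div_nonneg (by linarith [hcon T le_rfl]) hη.le
      linarith
    have hb := image_le_of_deriv_right_le_deriv_boundary (f := y) (f' := y') (a := T) (b := t₂)
      (B := fun s => (c - η) * s + (y T - (c - η) * T)) (B' := fun _ => c - η)
      (fun s hs => (hy s (by linarith [hs.1])).continuousAt.continuousWithinAt)
      (fun s hs => (hy s (by linarith [hs.1])).hasDerivWithinAt) (by simp)
      (fun s _ => (hline _ _ s).continuousAt.continuousWithinAt)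
      (fun s _ => (hline _ _ s).hasDerivWithinAt)
      (fun s hs => (hT s hs.1).1 (hcon s hs.1).le) (x := t₂) ⟨hT2, le_rfl⟩
    have h3 := hcon t₂ hT2
    have h4 : η * ((y T - c * T) / η) = y T - c * T := mul_div_cancel₀ _ hη.ne'
    have h5 : η * (t₂ - T) = y T - c * T + η := by
      rw [show t₂ - T = (y T - c * T) / η + 1 by rw [ht₂]; ring, mul_add, h4, mul_one]
    linarith
  filter_upwards [eventually_ge_atTop t₁] with t ht
  -- No upward crossing after `t₁`: at a contact point the slope of `y` is below `c`.
  have hb := image_le_of_deriv_right_lt_deriv_boundary (f := y) (f' := y') (a := t₁) (b := t)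
    (B := fun s => c * s + 0) (B' := fun _ => c)
    (fun s hs => (hy s (by linarith [hs.1])).continuousAt.continuousWithinAt)
    (fun s hs => (hy s (by linarith [hs.1])).hasDerivWithinAt) (by simpa using hle)
    (fun s => hline _ _ s)
    (fun s hs he => by
      have := (hT s (by linarith [hs.1])).1 (by linarith)
      linarith) (x := t) ⟨ht, le_rfl⟩
  simpa using hb

lemma eventually_line_le_of_le_deriv {y y' : ℝ → ℝ} {c η : ℝ} (hη : 0 < η)
    (hy : ∀ t > 0, HasDerivAt y (y' t) t)
    (h : ∀ᶠ t in atTop, y t ≤ c * t → c + η ≤ y' t) :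
    ∀ᶠ t in atTop, c * t ≤ y t := by
  have h1 := eventually_le_line_of_deriv_le (y := fun t => -y t) (y' := fun t => -y' t)
    (c := -c) hη (fun t ht => (hy t ht).neg)
    (h.mono fun t ht hle => by have := ht (by linarith); linarith)
  filter_upwards [h1] with t ht
  linarith

/-- Asymptotic monotonicity in quantitative form. -/
lemma AsympIncreasingAtZero.exists_le_mul {f : ℝ → ℝ} (hf : AsympIncreasingAtZero f)
    (hpos : ∀ y > 0, 0 < f y) {K : ℝ} (hK : 1 < K) :
    ∃ r > 0, ∀ u v, 0 < u → u ≤ v → v < r → f u ≤ K * f v := by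
  obtain ⟨φ, δ, hδ, hmono, hlim⟩ := hf
  obtain ⟨a, ha1, haK⟩ := exists_between hK
  have ha0 : 0 < a := by linarith
  have hb : a / K < 1 := (div_lt_one (by linarith)).2 haK
  have hb0 : 0 < a / K := by positivity
  -- This window around 1 yields `f u < a * φ u ≤ a * φ v < K * f v`.
  have h1 : ∀ᶠ y in 𝓝[>] (0 : ℝ), f y / φ y ∈ Ioo (a / K) a :=
    hlim (Ioo_mem_nhds hb ha1)
  obtain ⟨r, hr, hsub⟩ := mem_nhdsGT_iff_exists_Ioo_subset.1 h1
  refine ⟨min r δ, lt_min hr hδ, fun u v hu huv hv => ?_⟩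
  have hvr : v < r := hv.trans_le (min_le_left _ _)
  have hvδ : v < δ := hv.trans_le (min_le_right _ _)
  have hφ : ∀ w, 0 < w → w < r → 0 < φ w := fun w hw hwr => by
    have h2 : f w / φ w ∈ Ioo (a / K) a := hsub ⟨hw, hwr⟩
    exact (div_pos_iff_of_pos_left (hpos w hw)).1 (hb0.trans h2.1)
  have hu1 : f u / φ u ∈ Ioo (a / K) a := hsub ⟨hu, huv.trans_lt hvr⟩
  have hv1 : f v / φ v ∈ Ioo (a / K) a := hsub ⟨hu.trans_le huv, hvr⟩
  have h3 := (div_lt_iff₀ (hφ u hu (huv.trans_lt hvr))).1 hu1.2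
  have h4 := (lt_div_iff₀ (hφ v (hu.trans_le huv) hvr)).1 hv1.1
  have h5 : φ u ≤ φ v := hmono ⟨hu, huv.trans_lt hvδ⟩ ⟨hu.trans_le huv, hvδ⟩ huv
  have h6 : K * (a / K * φ v) = a * φ v := by field_simp
  nlinarith [mul_le_mul_of_nonneg_left h5 ha0.le, mul_lt_mul_of_pos_left h4 (by linarith : 0 < K)]

/-! ### The function `F` and its inverse -/

section DecayF

variable {f : ℝ → ℝ}

lemma hasDerivAt_decayF (hc : Continuous f) (hpos : ∀ y > 0, 0 < f y) {y : ℝ} (hy : 0 < y) :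
    HasDerivAt (decayF f) (-(1 / f y)) y := by
  have hcont : ContinuousOn (fun u => 1 / f u) (Ioi 0) :=
    continuousOn_const.div hc.continuousOn fun u hu => (hpos u hu).ne'
  have hnhds : Ioi (0 : ℝ) ∈ 𝓝 y := Ioi_mem_nhds hy
  refine intervalIntegral.integral_hasDerivAt_left ?_ ?_ (hcont.continuousAt hnhds)
  · refine (hcont.mono fun u hu => ?_).intervalIntegrable
    exact (lt_min hy one_pos).trans_le hu.1
  · exact hcont.stronglyMeasurableAtFilter isOpen_Ioi y hy

lemma strictAntiOn_decayF (hc : Continuous f) (hpos : ∀ y > 0, 0 < f y) :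
    StrictAntiOn (decayF f) (Ioi 0) := by
  refine strictAntiOn_of_deriv_neg (convex_Ioi 0)
    (fun y hy => (hasDerivAt_decayF hc hpos hy).continuousAt.continuousWithinAt) fun y hy => ?_
  rw [interior_Ioi] at hy
  rw [(hasDerivAt_decayF hc hpos hy).deriv]
  exact neg_neg_of_pos (one_div_pos.2 (hpos y hy))

/-- The Lipschitz bound `f u ≤ K * u` near 0 makes `F` grow at least like `-log y / K`. -/
lemma tendsto_decayF_nhdsGT_zero (hlip : LocallyLipschitz f) (hf0 : f 0 = 0)
    (hpos : ∀ y > 0, 0 < f y) : Tendsto (decayF f) (𝓝[>] 0) atTop := by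
  have hc := hlip.continuous
  obtain ⟨K, s, hs, hK⟩ := hlip 0
  obtain ⟨r, hr, hsub⟩ := mem_nhdsGT_iff_exists_Ioo_subset.1 (mem_nhdsWithin_of_mem_nhds hs :
    s ∈ 𝓝[>] (0 : ℝ))
  have hr0 : (0 : ℝ) < r := hr
  have hle : ∀ u ∈ Ioo 0 r, f u ≤ (K : ℝ) * u := fun u hu => by
    have h1 := hK.dist_le_mul u (hsub hu) 0 (mem_of_mem_nhds hs)
    rw [hf0, Real.dist_eq, Real.dist_eq, sub_zero, sub_zero, abs_of_pos hu.1,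
      abs_of_pos (hpos u hu.1)] at h1
    exact h1
  have hK0 : 0 < (K : ℝ) := by
    have h1 := hle (r / 2) ⟨by linarith, by linarith⟩
    have h2 := hpos (r / 2) (by linarith)
    by_contra! h3
    nlinarith
  have hd : ∀ y ∈ Ioo 0 r, HasDerivAt (fun y => decayF f y + (K : ℝ)⁻¹ * Real.log y)
      (-(1 / f y) + (K : ℝ)⁻¹ * y⁻¹) y := fun y hy =>
    (hasDerivAt_decayF hc hpos hy.1).add ((Real.hasDerivAt_log hy.1.ne').const_mul _)
  have hanti : AntitoneOn (fun y => decayF f y + (K : ℝ)⁻¹ * Real.log y) (Ioo 0 r) := by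
    refine antitoneOn_of_deriv_nonpos (convex_Ioo 0 r)
      (fun y hy => (hd y hy).continuousAt.continuousWithinAt) ?_ ?_
    · rw [interior_Ioo]
      exact fun y hy => (hd y hy).differentiableAt.differentiableWithinAt
    · rw [interior_Ioo]
      intro y hy
      rw [(hd y hy).deriv, ← mul_inv, ← one_div]
      linarith [one_div_le_one_div_of_le (hpos y hy.1) (hle y hy)]
  have hlog : Tendsto (fun y => decayF f (r / 2) + (K : ℝ)⁻¹ * Real.log (r / 2)
      + (K : ℝ)⁻¹ * -Real.log y) (𝓝[>] 0) atTop :=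
    tendsto_atTop_add_const_left _ _
      ((tendsto_neg_atBot_atTop.comp Real.tendsto_log_nhdsGT_zero).const_mul_atTop
        (inv_pos.2 hK0))
  refine tendsto_atTop_mono' _ ?_ hlog
  filter_upwards [Ioo_mem_nhdsGT (by linarith : 0 < r / 2)] with y hy
  have := hanti ⟨hy.1, by linarith [hy.2]⟩ ⟨by linarith, by linarith⟩ hy.2.le
  simp only at this
  linarith

lemma decayF_one : decayF f 1 = 0 := by simp [decayF]

lemma exists_decayF_eq (hlip : LocallyLipschitz f) (hf0 : f 0 = 0)
    (hpos : ∀ y > 0, 0 < f y) {t : ℝ} (ht : 0 ≤ t) : ∃ y ∈ Ioi (0 : ℝ), decayF f y = t := by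
  have hc := hlip.continuous
  obtain ⟨a, hat, ha⟩ := (((tendsto_decayF_nhdsGT_zero hlip hf0 hpos).eventually_ge_atTop t).and
    self_mem_nhdsWithin).exists
  have hcont : ContinuousOn (decayF f) (Ioi 0) :=
    fun y hy => (hasDerivAt_decayF hc hpos hy).continuousAt.continuousWithinAt
  exact isPreconnected_Ioi.intermediate_value (mem_Ioi.2 one_pos) ha hcont
    ⟨by rw [decayF_one]; exact ht, hat⟩

lemma decayFInv_pos (hlip : LocallyLipschitz f) (hf0 : f 0 = 0)
    (hpos : ∀ y > 0, 0 < f y) {t : ℝ} (ht : 0 ≤ t) : 0 < decayFInv f t :=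
  Function.invFunOn_mem (exists_decayF_eq hlip hf0 hpos ht)

lemma decayF_decayFInv (hlip : LocallyLipschitz f) (hf0 : f 0 = 0)
    (hpos : ∀ y > 0, 0 < f y) {t : ℝ} (ht : 0 ≤ t) : decayF f (decayFInv f t) = t :=
  Function.invFunOn_eq (exists_decayF_eq hlip hf0 hpos ht)

lemma tendsto_decayFInv (hlip : LocallyLipschitz f) (hf0 : f 0 = 0)
    (hpos : ∀ y > 0, 0 < f y) : Tendsto (decayFInv f) atTop (𝓝[>] 0) := by
  refine tendsto_nhdsWithin_iff.2 ⟨tendsto_order.2 ⟨fun a ha => ?_, fun a ha => ?_⟩, ?_⟩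
  · filter_upwards [eventually_ge_atTop 0] with t ht
    exact ha.trans (decayFInv_pos hlip hf0 hpos ht)
  · filter_upwards [eventually_ge_atTop 0, eventually_gt_atTop (decayF f a)] with t ht hta
    rw [← decayF_decayFInv hlip hf0 hpos ht] at hta
    exact ((strictAntiOn_decayF hlip.continuous hpos).lt_iff_gt ha
      (decayFInv_pos hlip hf0 hpos ht)).1 hta
  · filter_upwards [eventually_ge_atTop 0] with t ht
    exact decayFInv_pos hlip hf0 hpos ht

end DecayF

/-! ### Regular variation of `F` and of `f ∘ F⁻¹` -/

section RegularVariation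

variable {f : ℝ → ℝ} {β : ℝ}

/-- By L'Hôpital, since the ratio of derivatives is `c * f y / f (c * y)`. -/
lemma RegVaryAtZero.tendsto_decayF_mul_div (hf : RegVaryAtZero f β)
    (hlip : LocallyLipschitz f) (hf0 : f 0 = 0) {c : ℝ} (hc : 0 < c) :
    Tendsto (fun y => decayF f (c * y) / decayF f y) (𝓝[>] 0) (𝓝 (c ^ (1 - β))) := by
  have hpos := hf.2.1
  refine tendsto_div_of_tendsto_deriv_div (p' := fun y => -(1 / f (c * y)) * c)
    (q' := fun y => -(1 / f y)) (fun y hy => ?_)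
    (fun y hy => hasDerivAt_decayF hlip.continuous hpos hy)
    (fun y hy => neg_neg_of_pos (one_div_pos.2 (hpos y hy)))
    (tendsto_decayF_nhdsGT_zero hlip hf0 hpos) ?_
  · exact (hasDerivAt_decayF hlip.continuous hpos (mul_pos hc hy)).comp y
      (by simpa using (hasDerivAt_id y).const_mul c)
  · have h1 := ((hf.2.2 c hc).inv₀ (Real.rpow_pos_of_pos hc β).ne').const_mul c
    rw [← Real.rpow_neg hc.le, show c * c ^ (-β) = c ^ (1 - β) by
      rw [sub_eq_add_neg, Real.rpow_add hc, Real.rpow_one]] at h1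
    refine h1.congr' ?_
    filter_upwards [self_mem_nhdsWithin] with y hy
    have h2 := (hpos y hy).ne'
    have h3 := (hpos (c * y) (mul_pos hc hy)).ne'
    field_simp

/-- Regular variation of `f` at `0` passes to `f ∘ F⁻¹` at infinity. -/
lemma RegVaryAtZero.tendsto_comp_decayFInv (hf : RegVaryAtZero f β) (hβ : 1 < β)
    (hlip : LocallyLipschitz f) (hf0 : f 0 = 0) (hmono : AsympIncreasingAtZero f)
    {c : ℝ} (hc : 0 < c) :
    Tendsto (fun t => f (decayFInv f (c * t)) / f (decayFInv f t)) atTop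
      (𝓝 (c ^ (-β / (β - 1)))) := by
  have hpos := hf.2.1
  have hanti := strictAntiOn_decayF hlip.continuous hpos
  have hG := tendsto_decayFInv hlip hf0 hpos
  have hct : Tendsto (fun t : ℝ => c * t) atTop atTop := tendsto_id.const_mul_atTop hc
  have hGc := hG.comp hct
  -- As `F` has index `1 - β`, `F⁻¹(c t)` should behave like `μ F⁻¹(t)` with `μ ^ (1 - β) = c`,
  -- which scales `f` by `μ ^ β`. Each bound uses a factor `κ` on one side of `μ`.
  set μ := c ^ (-1 / (β - 1)) with hμ
  have hμ0 : 0 < μ := Real.rpow_pos_of_pos hc _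
  have hμc : μ ^ (1 - β) = c := by
    rw [hμ, ← Real.rpow_mul hc.le, show -1 / (β - 1) * (1 - β) = 1 by
      have : β - 1 ≠ 0 := by linarith
      field_simp; ring, Real.rpow_one]
  have hμβ : c ^ (-β / (β - 1)) = μ ^ β := by
    rw [hμ, ← Real.rpow_mul hc.le]
    congr 1
    ring
  have hcont : ContinuousAt (fun κ : ℝ => κ ^ β) μ :=
    Real.continuousAt_rpow_const _ _ (Or.inl hμ0.ne')
  have hF : ∀ κ > 0, Tendsto (fun t => decayF f (κ * decayFInv f t) / t) atTop
      (𝓝 (κ ^ (1 - β))) := fun κ hκ => by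
    refine ((hf.tendsto_decayF_mul_div hlip hf0 hκ).comp hG).congr' ?_
    filter_upwards [eventually_ge_atTop 0] with t ht
    simp only [Function.comp_apply, decayF_decayFInv hlip hf0 hpos ht]
  have hκ0 : ∀ κ : ℝ, Tendsto (fun t => κ * decayFInv f t) atTop (𝓝 0) := fun κ => by
    simpa using (tendsto_nhds_of_tendsto_nhdsWithin hG).const_mul κ
  rw [hμβ]
  refine tendsto_order.2 ⟨fun a ha => ?_, fun a ha => ?_⟩
  · rcases le_or_gt a 0 with ha0 | ha0
    · filter_upwards [eventually_ge_atTop 0] with t ht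
      exact ha0.trans_lt (div_pos (hpos _ (decayFInv_pos hlip hf0 hpos (by positivity)))
        (hpos _ (decayFInv_pos hlip hf0 hpos ht)))
    · obtain ⟨κ, ⟨hκa, hκ⟩, hκμ⟩ := ((((hcont.eventually_const_lt ha).and
        (eventually_gt_nhds hμ0)).filter_mono nhdsWithin_le_nhds).and
        (self_mem_nhdsWithin : Iio μ ∈ 𝓝[<] μ)).exists
      obtain ⟨b, hab, hbκ⟩ := exists_between hκa
      -- The slack `b / a` is the price of passing from `f (κ * F⁻¹(t))` to `f (F⁻¹(c t))` by
      -- asymptotic monotonicity.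
      obtain ⟨r, hr, hle⟩ := hmono.exists_le_mul hpos ((one_lt_div ha0).2 hab)
      have h1 : c < κ ^ (1 - β) := by
        rw [← hμc]
        exact Real.rpow_lt_rpow_of_neg hκ hκμ (by linarith)
      filter_upwards [eventually_gt_atTop 0, (hF κ hκ).eventually_const_lt h1,
        ((hf.2.2 κ hκ).comp hG).eventually_const_lt hbκ,
        (tendsto_nhds_of_tendsto_nhdsWithin hGc).eventually_lt_const hr] with t ht h2 h3 h4
      have hGt := decayFInv_pos hlip hf0 hpos ht.le
      have hGct := decayFInv_pos hlip hf0 hpos (mul_pos hc ht).le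
      have h5 : κ * decayFInv f t < decayFInv f (c * t) := by
        refine (hanti.lt_iff_gt hGct (mul_pos hκ hGt)).1 ?_
        rw [decayF_decayFInv hlip hf0 hpos (mul_pos hc ht).le]
        exact (lt_div_iff₀ ht).1 h2
      have h6 := hle _ _ (mul_pos hκ hGt) h5.le h4
      have hfG := hpos _ hGt
      simp only [Function.comp_apply] at h3
      rw [lt_div_iff₀ hfG] at h3 ⊢
      have h7 : b * (a * f (decayFInv f t)) < b * f (decayFInv f (c * t)) := by
        rw [div_mul_eq_mul_div, le_div_iff₀ ha0] at h6
        nlinarith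
      exact lt_of_mul_lt_mul_left h7 (by linarith)
  · obtain ⟨κ, hκa, hκμ⟩ := (((hcont.eventually_lt_const ha).filter_mono nhdsWithin_le_nhds).and
      (self_mem_nhdsWithin : Ioi μ ∈ 𝓝[>] μ)).exists
    have hκ : 0 < κ := hμ0.trans hκμ
    obtain ⟨b, hκb, hba⟩ := exists_between hκa
    have hb0 : 0 < b := (Real.rpow_pos_of_pos hκ β).trans hκb
    obtain ⟨r, hr, hle⟩ := hmono.exists_le_mul hpos ((one_lt_div hb0).2 hba)
    have h1 : κ ^ (1 - β) < c := by
      rw [← hμc]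
      exact Real.rpow_lt_rpow_of_neg hμ0 hκμ (by linarith)
    filter_upwards [eventually_gt_atTop 0, (hF κ hκ).eventually_lt_const h1,
      ((hf.2.2 κ hκ).comp hG).eventually_lt_const hκb,
      (hκ0 κ).eventually_lt_const hr] with t ht h2 h3 h4
    have hGt := decayFInv_pos hlip hf0 hpos ht.le
    have hGct := decayFInv_pos hlip hf0 hpos (mul_pos hc ht).le
    have h5 : decayFInv f (c * t) < κ * decayFInv f t := by
      refine (hanti.lt_iff_gt (mul_pos hκ hGt) hGct).1 ?_
      rw [decayF_decayFInv hlip hf0 hpos (mul_pos hc ht).le]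
      exact (div_lt_iff₀ ht).1 h2
    have h6 := hle _ _ hGct h5.le h4
    have hfG := hpos _ hGt
    simp only [Function.comp_apply] at h3
    rw [div_lt_iff₀ hfG] at h3 ⊢
    rw [div_mul_eq_mul_div, le_div_iff₀ hb0] at h6
    have h7 : b * f (decayFInv f (c * t)) < b * (a * f (decayFInv f t)) := by
      nlinarith
    exact lt_of_mul_lt_mul_left h7 hb0.le

end RegularVariation

/-! ### Behaviour of the perturbed solution -/

section Solution

variable {f g x : ℝ → ℝ} {ξ : ℝ}

/-- At a first zero `s` the equation gives `x' s = g s > 0`, whereas positivity just before `s`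
forces `x' s ≤ 0`. -/
lemma IsPerturbedSolution.pos (hx : IsPerturbedSolution f g ξ x) (hξ : 0 < ξ) (hf0 : f 0 = 0)
    (hg : ∀ t > 0, 0 < g t) {t : ℝ} (ht : 0 ≤ t) : 0 < x t := by
  by_contra! hxt
  have hcont : ContinuousOn x (Icc 0 t) := hx.continuousOn.mono Icc_subset_Ici_self
  set S := Icc 0 t ∩ x ⁻¹' Iic 0 with hS
  have hSc : IsCompact S :=
    isCompact_Icc.of_isClosed_subset (hcont.preimage_isClosed_of_isClosed isClosed_Icc isClosed_Iic)
      inter_subset_left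
  obtain ⟨s, hs, hmin⟩ := hSc.exists_isLeast ⟨t, ⟨ht, le_rfl⟩, hxt⟩
  have hxs : x s ≤ 0 := hs.2
  have hs0 : 0 < s := by
    refine lt_of_le_of_ne hs.1.1 fun h => ?_
    rw [← h, hx.init] at hxs
    linarith
  have hbefore : ∀ u ∈ Ioo 0 s, 0 < x u := fun u hu => by
    by_contra! h
    exact absurd (hmin ⟨⟨hu.1.le, hu.2.le.trans hs.1.2⟩, h⟩) (not_le.2 hu.2)
  have hd := hx.hasDerivAt s hs0
  have hev : ∀ᶠ u in 𝓝[<] s, 0 < x u := by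
    filter_upwards [Ioo_mem_nhdsLT hs0] with u hu using hbefore u hu
  have hxs0 : x s = 0 := le_antisymm hxs <|
    ge_of_tendsto (hd.continuousAt.tendsto.mono_left nhdsWithin_le_nhds)
      (hev.mono fun u hu => hu.le)
  rw [hxs0, hf0, neg_zero, zero_add] at hd
  have hslope := hd.tendsto_slope.mono_left
    (nhdsWithin_mono s fun u (hu : u < s) => hu.ne : 𝓝[<] s ≤ 𝓝[≠] s)
  have hle : g s ≤ 0 := by
    refine le_of_tendsto hslope ?_
    filter_upwards [hev, self_mem_nhdsWithin] with u hu hus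
    rw [slope_def_field, hxs0, sub_zero]
    exact (div_neg_of_pos_of_neg hu (sub_neg.2 hus)).le
  linarith [hg s hs0]

lemma IsPerturbedSolution.hasDerivAt_decayF (hx : IsPerturbedSolution f g ξ x) (hξ : 0 < ξ)
    (hg : ∀ t > 0, 0 < g t) (hlip : LocallyLipschitz f) (hf0 : f 0 = 0)
    (hpos : ∀ y > 0, 0 < f y) {t : ℝ} (ht : 0 < t) :
    HasDerivAt (fun t => decayF f (x t)) (1 - g t / f (x t)) t := by
  have hxt := hx.pos hξ hf0 hg ht.le
  have h := (_root_.hasDerivAt_decayF hlip.continuous hpos hxt).comp t (hx.hasDerivAt t ht)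
  refine h.congr_deriv ?_
  have := (hpos _ hxt).ne'
  field_simp
  ring

/-- If `g t` is eventually at least `m * f (F⁻¹ (c t))` with `m > 1 - c`, then `F (x t)` ends up
below the line `c * t`. -/
lemma IsPerturbedSolution.eventually_decayF_le (hx : IsPerturbedSolution f g ξ x) (hξ : 0 < ξ)
    (hg : ∀ t > 0, 0 < g t) (hlip : LocallyLipschitz f) (hf0 : f 0 = 0)
    (hpos : ∀ y > 0, 0 < f y) (hmono : AsympIncreasingAtZero f)
    {c m : ℝ} (hc : 0 < c) (hm : 0 ≤ m) (hcm : 1 - c < m)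
    (h : ∀ᶠ t in atTop, m ≤ g t / f (decayFInv f (c * t))) :
    ∀ᶠ t in atTop, decayF f (x t) ≤ c * t := by
  have hG := (tendsto_decayFInv hlip hf0 hpos).comp
    (tendsto_id.const_mul_atTop hc : Tendsto (fun t : ℝ => c * t) atTop atTop)
  obtain ⟨K, hK, hKm⟩ : ∃ K > 1, 1 - c < m / K := by
    have hcont : ContinuousAt (fun K : ℝ => m / K) 1 :=
      continuousAt_const.div continuousAt_id one_ne_zero
    obtain ⟨K, hK1, hK2⟩ := (((hcont.eventually_const_lt (u := 1 - c)
      (by simpa using hcm)).filter_mono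
      nhdsWithin_le_nhds).and (self_mem_nhdsWithin : Ioi (1 : ℝ) ∈ 𝓝[>] 1)).exists
    exact ⟨K, hK2, hK1⟩
  have hK0 : 0 < K := by linarith
  obtain ⟨r, hr, hle⟩ := hmono.exists_le_mul hpos hK
  refine eventually_le_line_of_deriv_le (η := m / K - (1 - c)) (by linarith)
    (fun t ht => hx.hasDerivAt_decayF hξ hg hlip hf0 hpos ht) ?_
  filter_upwards [h, eventually_gt_atTop 0,
    (tendsto_nhds_of_tendsto_nhdsWithin hG).eventually_lt_const hr] with t h1 ht h2 h3
  have hxt := hx.pos hξ hf0 hg ht.le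
  have hGt := decayFInv_pos hlip hf0 hpos (mul_pos hc ht).le
  have h4 : x t ≤ decayFInv f (c * t) := by
    refine ((strictAntiOn_decayF hlip.continuous hpos).le_iff_ge hGt hxt).1 ?_
    rwa [decayF_decayFInv hlip hf0 hpos (mul_pos hc ht).le]
  have h5 := hle _ _ hxt h4 h2
  rw [le_div_iff₀ (hpos _ hGt)] at h1
  have h6 : m / K ≤ g t / f (x t) := by
    rw [div_le_div_iff₀ hK0 (hpos _ hxt)]
    nlinarith [mul_le_mul_of_nonneg_left h5 hm]
  linarith

/-- If `g t` is eventually at most `m * f (F⁻¹ (c t))` with `m < 1 - c`, then `F (x t)` ends up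
above the line `c * t`. -/
lemma IsPerturbedSolution.eventually_le_decayF (hx : IsPerturbedSolution f g ξ x) (hξ : 0 < ξ)
    (hg : ∀ t > 0, 0 < g t) (hlip : LocallyLipschitz f) (hf0 : f 0 = 0)
    (hpos : ∀ y > 0, 0 < f y) (hmono : AsympIncreasingAtZero f)
    (hx_lim : Tendsto x atTop (𝓝 0))
    {c m : ℝ} (hc : 0 < c) (hm : 0 ≤ m) (hcm : m < 1 - c)
    (h : ∀ᶠ t in atTop, g t / f (decayFInv f (c * t)) ≤ m) :
    ∀ᶠ t in atTop, c * t ≤ decayF f (x t) := by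
  obtain ⟨K, hK, hKm⟩ : ∃ K > 1, K * m < 1 - c := by
    have hcont : ContinuousAt (fun K : ℝ => K * m) 1 := by fun_prop
    obtain ⟨K, hK1, hK2⟩ := (((hcont.eventually_lt_const (u := 1 - c)
      (by simpa using hcm)).filter_mono
      nhdsWithin_le_nhds).and (self_mem_nhdsWithin : Ioi (1 : ℝ) ∈ 𝓝[>] 1)).exists
    exact ⟨K, hK2, hK1⟩
  obtain ⟨r, hr, hle⟩ := hmono.exists_le_mul hpos hK
  refine eventually_line_le_of_le_deriv (η := 1 - c - K * m) (by linarith)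
    (fun t ht => hx.hasDerivAt_decayF hξ hg hlip hf0 hpos ht) ?_
  filter_upwards [h, eventually_gt_atTop 0, hx_lim.eventually_lt_const hr] with t h1 ht h2 h3
  have hxt := hx.pos hξ hf0 hg ht.le
  have hGt := decayFInv_pos hlip hf0 hpos (mul_pos hc ht).le
  have h4 : decayFInv f (c * t) ≤ x t := by
    refine ((strictAntiOn_decayF hlip.continuous hpos).le_iff_ge hxt hGt).1 ?_
    rwa [decayF_decayFInv hlip hf0 hpos (mul_pos hc ht).le]
  have h5 := hle _ _ hGt h4 h2
  rw [div_le_iff₀ (hpos _ hGt)] at h1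
  have h6 : g t / f (x t) ≤ K * m := by
    rw [div_le_iff₀ (hpos _ hxt)]
    nlinarith [mul_le_mul_of_nonneg_left h5 hm]
  linarith

/-- The case of a finite limit `l` of `g / (f ∘ F⁻¹)`, for `f ∘ F⁻¹` of index `-γ`. -/
lemma IsPerturbedSolution.tendsto_decayF_div (hx : IsPerturbedSolution f g ξ x) (hξ : 0 < ξ)
    (hg : ∀ t > 0, 0 < g t) (hlip : LocallyLipschitz f) (hf0 : f 0 = 0)
    (hpos : ∀ y > 0, 0 < f y) (hmono : AsympIncreasingAtZero f)
    (hx_lim : Tendsto x atTop (𝓝 0)) {γ l Λ : ℝ} (hγ : 0 < γ)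
    (hRV : ∀ c > 0, Tendsto (fun t => f (decayFInv f (c * t)) / f (decayFInv f t)) atTop
      (𝓝 (c ^ (-γ))))
    (hgl : Tendsto (fun t => g t / f (decayFInv f t)) atTop (𝓝 l))
    (hΛ : 0 < Λ) (hl : 0 ≤ l) (hΛl : 1 - Λ = l * Λ ^ γ) :
    Tendsto (fun t => decayF f (x t) / t) atTop (𝓝 Λ) := by
  have hlim : ∀ c > 0, Tendsto (fun t => g t / f (decayFInv f (c * t))) atTop
      (𝓝 (l * c ^ γ)) := fun c hc => by
    have h1 := hgl.div (hRV c hc) (Real.rpow_pos_of_pos hc _).ne'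
    rw [Real.rpow_neg hc.le, div_inv_eq_mul] at h1
    refine h1.congr' ?_
    filter_upwards [eventually_ge_atTop 0] with t ht
    have h2 := (hpos _ (decayFInv_pos hlip hf0 hpos ht)).ne'
    have h3 := (hpos _ (decayFInv_pos hlip hf0 hpos (mul_nonneg hc.le ht))).ne'
    simp only [Pi.div_apply]
    field_simp
  have hlower : ∀ c, 0 < c → c < Λ → ∀ᶠ t in atTop, c * t ≤ decayF f (x t) := fun c hc hcΛ => by
    have h1 : l * c ^ γ < 1 - c := by
      have := mul_le_mul_of_nonneg_left (Real.rpow_le_rpow hc.le hcΛ.le hγ.le) hl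
      linarith
    obtain ⟨m, hm1, hm2⟩ := exists_between h1
    exact hx.eventually_le_decayF hξ hg hlip hf0 hpos hmono hx_lim hc
      ((mul_nonneg hl (Real.rpow_nonneg hc.le γ)).trans hm1.le) hm2
      ((hlim c hc).eventually_le_const hm1)
  have hupper : ∀ c, Λ < c → ∀ᶠ t in atTop, decayF f (x t) ≤ c * t := fun c hcΛ => by
    have hc : 0 < c := hΛ.trans hcΛ
    rcases le_or_gt (1 - c) 0 with h0 | h0
    -- The threshold `m` must be nonnegative: for `c > 1` the choice `m = 0` works, while `c = 1`
    -- needs `l > 0`, which holds because `l = 0` would give `Λ = 1 = c`.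
    · rcases h0.lt_or_eq with h0 | h0
      · refine hx.eventually_decayF_le hξ hg hlip hf0 hpos hmono hc le_rfl h0 ?_
        filter_upwards [eventually_gt_atTop 0] with t ht
        exact (div_pos (hg t ht) (hpos _ (decayFInv_pos hlip hf0 hpos (mul_pos hc ht).le))).le
      · have h1 : 0 < l * c ^ γ := by
          refine mul_pos (hl.lt_of_ne fun h => ?_) (Real.rpow_pos_of_pos hc γ)
          rw [← h] at hΛl
          linarith
        obtain ⟨m, hm1, hm2⟩ := exists_between h1
        exact hx.eventually_decayF_le hξ hg hlip hf0 hpos hmono hc hm1.le (by linarith)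
          ((hlim c hc).eventually_const_le hm2)
    · have h1 : 1 - c < l * c ^ γ := by
        have := mul_le_mul_of_nonneg_left (Real.rpow_le_rpow hΛ.le hcΛ.le hγ.le) hl
        linarith
      obtain ⟨m, hm1, hm2⟩ := exists_between h1
      exact hx.eventually_decayF_le hξ hg hlip hf0 hpos hmono hc (h0.trans hm1).le hm1
        ((hlim c hc).eventually_const_le hm2)
  refine tendsto_order.2 ⟨fun a ha => ?_, fun a ha => ?_⟩
  · obtain ⟨c, hc1, hc2⟩ := exists_between (max_lt ha hΛ)
    filter_upwards [eventually_gt_atTop 0, hlower c ((le_max_right _ _).trans_lt hc1) hc2]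
      with t ht h
    exact ((le_max_left _ _).trans_lt hc1).trans_le ((le_div_iff₀ ht).2 h)
  · obtain ⟨c, hc1, hc2⟩ := exists_between ha
    filter_upwards [eventually_gt_atTop 0, hupper c hc1] with t ht h
    exact ((div_le_iff₀ ht).2 h).trans_lt hc2

/-- The case `g / (f ∘ F⁻¹) → ∞`. -/
lemma IsPerturbedSolution.tendsto_decayF_div_zero (hx : IsPerturbedSolution f g ξ x) (hξ : 0 < ξ)
    (hg : ∀ t > 0, 0 < g t) (hlip : LocallyLipschitz f) (hf0 : f 0 = 0)
    (hpos : ∀ y > 0, 0 < f y) (hmono : AsympIncreasingAtZero f)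
    (hx_lim : Tendsto x atTop (𝓝 0)) {γ : ℝ}
    (hRV : ∀ c > 0, Tendsto (fun t => f (decayFInv f (c * t)) / f (decayFInv f t)) atTop
      (𝓝 (c ^ (-γ))))
    (hgl : Tendsto (fun t => g t / f (decayFInv f t)) atTop atTop) :
    Tendsto (fun t => decayF f (x t) / t) atTop (𝓝 0) := by
  have hlim : ∀ c > 0, Tendsto (fun t => g t / f (decayFInv f (c * t))) atTop atTop :=
    fun c hc => by
    have h0 := Real.rpow_pos_of_pos hc (-γ)
    have h1 := hgl.atTop_mul_pos (inv_pos.2 h0) ((hRV c hc).inv₀ h0.ne')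
    refine h1.congr' ?_
    filter_upwards [eventually_ge_atTop 0] with t ht
    have h2 := (hpos _ (decayFInv_pos hlip hf0 hpos ht)).ne'
    have h3 := (hpos _ (decayFInv_pos hlip hf0 hpos (mul_nonneg hc.le ht))).ne'
    field_simp
  refine tendsto_order.2 ⟨fun a ha => ?_, fun a ha => ?_⟩
  -- Once `x t < 1`, `F(x t) > F(1) = 0`.
  · filter_upwards [eventually_gt_atTop 0, hx_lim.eventually_lt_const one_pos] with t ht h1
    have h2 := strictAntiOn_decayF hlip.continuous hpos (hx.pos hξ hf0 hg ht.le)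
      (mem_Ioi.2 one_pos) h1
    rw [decayF_one] at h2
    exact ha.trans (div_pos h2 ht)
  · obtain ⟨c, hc1, hc2⟩ := exists_between ha
    filter_upwards [eventually_gt_atTop 0, hx.eventually_decayF_le hξ hg hlip hf0 hpos hmono hc1
      zero_le_one (by linarith) ((hlim c hc1).eventually_ge_atTop 1)] with t ht h
    exact ((div_le_iff₀ ht).2 h).trans_lt hc2

end Solution

/-! ### The equation for the limit `Λ` -/

lemma one_sub_mul_rpow_neg_eq_iff {γ l Λ : ℝ} (hΛ : 0 < Λ) :
    (1 - Λ) * Λ ^ (-γ) = l ↔ 1 - Λ = l * Λ ^ γ := by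
  rw [Real.rpow_neg hΛ.le, ← div_eq_mul_inv, div_eq_iff (Real.rpow_pos_of_pos hΛ γ).ne']

lemma exists_one_sub_eq_mul_rpow {γ l : ℝ} (hγ : 0 < γ) (hl : 0 < l) :
    ∃ Λ ∈ Ioo (0 : ℝ) 1, 1 - Λ = l * Λ ^ γ := by
  have hcont : ContinuousOn (fun Λ : ℝ => Λ + l * Λ ^ γ) (Icc 0 1) :=
    (continuous_id.add (continuous_const.mul (Real.continuous_rpow_const hγ.le))).continuousOn
  obtain ⟨Λ, hΛ, h⟩ := intermediate_value_Ioo zero_le_one hcont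
    (show (1 : ℝ) ∈ _ from ⟨by simp [Real.zero_rpow hγ.ne'], by simpa using hl⟩)
  exact ⟨Λ, hΛ, by simp only at h; linarith⟩

/-- `Λ + l * Λ ^ γ` is strictly increasing on the positive axis. -/
lemma eq_of_one_sub_eq_mul_rpow {γ l a b : ℝ} (hγ : 0 < γ) (hl : 0 < l) (ha : 0 < a) (hb : 0 < b)
    (h1 : 1 - a = l * a ^ γ) (h2 : 1 - b = l * b ^ γ) : a = b := by
  have key : ∀ {u v : ℝ}, 0 < u → 1 - u = l * u ^ γ → 1 - v = l * v ^ γ → ¬ u < v := by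
    intro u v hu hu1 hv1 huv
    have := mul_lt_mul_of_pos_left (Real.rpow_lt_rpow hu.le huv hγ) hl
    linarith
  exact le_antisymm (not_lt.1 (key hb h2 h1)) (not_lt.1 (key ha h1 h2))

theorem mainTheorem2 (f g x : ℝ → ℝ) (ξ : ℝ) (L : EReal)
    (hf_sign : ∀ y : ℝ, y ≠ 0 → 0 < y * f y) (hf_zero : f 0 = 0)
    (hf_lip : LocallyLipschitz f)
    (hg_cont : ContinuousOn g (Ici 0)) (hg_pos : ∀ t > 0, 0 < g t)
    (hξ : 0 < ξ)
    (hRV : (∃ β : ℝ, 1 < β ∧ RegVaryAtZero f β) ∨ RegVaryAtInfty (f ∘ decayFInv f) (-1))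
    (hf_mono : AsympIncreasingAtZero f)
    (hx : IsPerturbedSolution f g ξ x)
    (hx_lim : Tendsto x atTop (𝓝 0))
    (hL : L ∈ Icc (0 : EReal) ⊤)
    (hgL : Tendsto (fun t : ℝ => ((g t / f (decayFInv f t) : ℝ) : EReal)) atTop (𝓝 L)) :
    (L = 0 → Tendsto (fun t => decayF f (x t) / t) atTop (𝓝 1)) ∧
    (∀ l : ℝ, 0 < l → L = (l : EReal) →
      (∀ β : ℝ, 1 < β → RegVaryAtZero f β →
        ∃ Λ ∈ Ioo (0 : ℝ) 1,
          (1 - Λ) * Λ ^ (-β / (β - 1)) = l ∧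
          (∀ Λ' > 0, (1 - Λ') * Λ' ^ (-β / (β - 1)) = l → Λ' = Λ) ∧
          Tendsto (fun t => decayF f (x t) / t) atTop (𝓝 Λ)) ∧
      (RegVaryAtInfty (f ∘ decayFInv f) (-1) →
        1 / (1 + l) ∈ Ioo (0 : ℝ) 1 ∧
          Tendsto (fun t => decayF f (x t) / t) atTop (𝓝 (1 / (1 + l))))) ∧
    (L = ⊤ → Tendsto (fun t => decayF f (x t) / t) atTop (𝓝 0)) := by
  have hpos : ∀ y > 0, 0 < f y := fun y hy => (pos_iff_pos_of_mul_pos (hf_sign y hy.ne')).1 hy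
  have hRV₀ : ∀ β : ℝ, 1 < β → RegVaryAtZero f β → 0 < β / (β - 1) ∧ ∀ c > 0,
      Tendsto (fun t => f (decayFInv f (c * t)) / f (decayFInv f t)) atTop
        (𝓝 (c ^ (-(β / (β - 1))))) := fun β hβ h =>
    ⟨div_pos (by linarith) (by linarith), fun c hc => by
      rw [← neg_div]
      exact h.tendsto_comp_decayFInv hβ hf_lip hf_zero hf_mono hc⟩
  -- For `L = 0` and `L = ∞` the limit does not depend on the index, so any `γ > 0` serves.
  have hRVγ : ∃ γ : ℝ, 0 < γ ∧ ∀ c > 0,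
      Tendsto (fun t => f (decayFInv f (c * t)) / f (decayFInv f t)) atTop (𝓝 (c ^ (-γ))) := by
    rcases hRV with ⟨β, hβ, h⟩ | h
    · exact ⟨_, hRV₀ β hβ h⟩
    · exact ⟨1, one_pos, h.2.2⟩
  obtain ⟨γ, hγ, hRVγ⟩ := hRVγ
  refine ⟨fun h0 => ?_, fun l hl hLl => ?_, fun htop => ?_⟩
  · rw [h0, ← EReal.coe_zero, EReal.tendsto_coe] at hgL
    exact hx.tendsto_decayF_div hξ hg_pos hf_lip hf_zero hpos hf_mono hx_lim hγ hRVγ hgL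
      one_pos le_rfl (by simp)
  · rw [hLl, EReal.tendsto_coe] at hgL
    refine ⟨fun β hβ h => ?_, fun h => ?_⟩
    · obtain ⟨hγ', hRV'⟩ := hRV₀ β hβ h
      obtain ⟨Λ, hΛ, hΛl⟩ := exists_one_sub_eq_mul_rpow hγ' hl
      rw [neg_div]
      refine ⟨Λ, hΛ, (one_sub_mul_rpow_neg_eq_iff hΛ.1).2 hΛl, fun Λ' hΛ' h' => ?_, ?_⟩
      · exact eq_of_one_sub_eq_mul_rpow hγ' hl hΛ' hΛ.1
          ((one_sub_mul_rpow_neg_eq_iff hΛ').1 h') hΛl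
      · exact hx.tendsto_decayF_div hξ hg_pos hf_lip hf_zero hpos hf_mono hx_lim hγ' hRV' hgL
          hΛ.1 hl.le hΛl
    · refine ⟨⟨by positivity, (div_lt_one (by linarith)).2 (by linarith)⟩, ?_⟩
      refine hx.tendsto_decayF_div hξ hg_pos hf_lip hf_zero hpos hf_mono hx_lim one_pos h.2.2 hgL
        (by positivity) hl.le ?_
      rw [Real.rpow_one]
      field_simp
      ring
  · rw [htop, EReal.tendsto_coe_nhds_top_iff] at hgL
    exact hx.tendsto_decayF_div_zero hξ hg_pos hf_lip hf_zero hpos hf_mono hx_lim hRVγ hgL
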